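/- Conventions. An $n$-qubit state is a nonzero vector $|\psi\rangle=\sum_{x\in\{0,1\}^n}\psi(x_n,\dots,x_1)\,|x_n\rangle\otimes\cdots\otimes|x_1\rangle$ (normalisation is omitted). A stabilizer state is, up to a nonzero scalar, the output of a circuit of Hadamard, phase ($S$) and CNOT gates on input $|0\rangle^{\otimes n}$. For a group $G$ of invertible $2\times2$ matrices, an $n$-qubit $G$-LIMDD is a finite rooted layered directed acyclic graph with node indices $0,\dots,n$: the root has index $n$, there is a unique leaf, of index $0$, and each node $v$ of index $k\ge 1$ has a low and a high edge, both to nodes of index $k-1$. Each edge $e$ to a node of index $k$, including a root edge to the root, carries a label that is either $0$ or an operator $\lambda\,Q_k\otimes\cdots\otimes Q_1$ with $\lambda\in\mathbb C\setminus\{0\}$ and all $Q_j\in G$. The leaf represents the number $1$; an edge $e$ with label $A$ to a node $w$ represents $|e\rangle=A|w\rangle$; a node $v$ represents $|v\rangle=|0\rangle\otimes|\mathrm{low}(v)\rangle+|1\rangle\otimes|\mathrm{high}(v)\rangle$; the diagram represents the vector of its root edge. Its size is the number of its non-leaf nodes. A Pauli-LIMDD is a $G$-LIMDD for the group $G$ generated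 by the Pauli matrices $X,Y,Z$; a QMDD is a $G$-LIMDD for $G=\{\mathbb I\}$. A family of states $(|\psi_i\rangle)_{i\in\mathbb N}$, with $|\psi_i\rangle$ on $m_i$ qubits, has polynomial-size diagrams of a given type if there is a polynomial $p$ such that each $|\psi_i\rangle$ is represented by such a diagram of size at most $p(m_i)$. Theorem. (1) The set of families of states with polynomial-size Pauli-LIMDDs is a strict superset of the union of the set of families of stabilizer states and the set of families of states with polynomial-size QMDDs. This holds for the given order of the qubits, and also if, for both types of diagrams, the order of the qubits may be chosen freely for each state. (2) Strictness is witnessed by $|\phi_n\rangle=(|0\rangle+e^{i\pi/4}|1\rangle)\otimes|G_n\rangle$, where $|G_n\rangle=\sum_{x}(-1)^{f_n(x)}|x\rangle$ is the cluster state on $n^2$ qubits, with $f_n(x)$ the number of edges of the subgraph of the $n\times n$ grid induced by the vertices $v$ with $x_v=1$. For every $n\ge 0$: the state $|\phi_n\rangle$ is not a stabilizer state; for every order of the $n^2+1$ qubits, each QMDD representing $|\phi_n\rangle$ has at least $2^{\lfloor n/12\rfloor}$ nodes; and $|\phi_n\rangle$ is represented by a Pauli-LIMDD with at most $n^2+1$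 nodes. -/

import Mathlib

open scoped Matrix

/-! ### Quantum states as amplitude functions

States are not normalised: a state vector of `n` qubits is its amplitude function
`(x₁, …, xₙ) ↦ f (xₙ, …, x₁)`. Position `j : Fin n` is qubit number `j + 1`, so that the
last position is the top qubit `n`. -/

/-- Vectors of the `n`-qubit space, as functions of the bit string. -/
abbrev QVec (n : ℕ) : Type := (Fin n → Fin 2) → ℂ

/-- `a ⊗ φ`, for a one-qubit vector `a` on the new top qubit. -/
def tensorTop {n : ℕ} (a : Fin 2 → ℂ) (φ : QVec n) : QVec (n + 1) :=
  fun x => a (x (Fin.last n)) * φ (Fin.init x)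

/-- The one-qubit basis vectors `|0⟩` and `|1⟩`. -/
def ket (b : Fin 2) : Fin 2 → ℂ := Pi.single b 1

/-- The matrix of `Qₙ ⊗ ⋯ ⊗ Q₁` in the computational basis. -/
def tensorOp {n : ℕ} (Q : Fin n → Matrix (Fin 2) (Fin 2) ℂ) :
    Matrix (Fin n → Fin 2) (Fin n → Fin 2) ℂ :=
  fun x y => ∏ j, Q j (x j) (y j)

/-- The state `ψ` with its qubits rearranged by `σ`. -/
def permuteQubits {n : ℕ} (σ : Equiv.Perm (Fin n)) (ψ : QVec n) : QVec n :=
  fun x => ψ (x ∘ σ)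

/-! ### Decision diagrams -/

/-- An edge label of a `G`-LIMDD, on an edge to a node at level `k`: `none` is the label `0`,
and `some (c, Q)` is the local invertible map `c • Q_k ⊗ ⋯ ⊗ Q_1` with `c ≠ 0`, `Q_j ∈ G`. -/
abbrev LIMLabel (G : Subgroup (GL (Fin 2) ℂ)) (k : ℕ) : Type :=
  Option (ℂˣ × (Fin k → G))

/-- The action of an edge label on a vector. -/
def LIMLabel.apply {G : Subgroup (GL (Fin 2) ℂ)} {k : ℕ} :
    LIMLabel G k → QVec k → QVec k
  | none, _ => 0
  | some (c, Q), φ => (c : ℂ) • (tensorOp (fun j => ((Q j : GL (Fin 2) ℂ) :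
      Matrix (Fin 2) (Fin 2) ℂ)) *ᵥ φ)

/-- An `n`-qubit `G`-LIMDD: a finite rooted layered directed acyclic graph. `Node k` is the set of
nodes of index `k`; the leaf is the only node of index `0`, the root has index `n`, and both edges
of a node of index `k + 1` lead to nodes of index `k`. -/
structure LIMDD (G : Subgroup (GL (Fin 2) ℂ)) (n : ℕ) where
  Node : Fin (n + 1) → Type
  fintypeNode : ∀ k, Fintype (Node k)
  leaf : Unique (Node 0)
  low : ∀ k : Fin n, Node k.succ → Node k.castSucc
  high : ∀ k : Fin n, Node k.succ → Node k.castSucc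
  lowLabel : ∀ k : Fin n, Node k.succ → LIMLabel G k
  highLabel : ∀ k : Fin n, Node k.succ → LIMLabel G k
  root : Node (Fin.last n)
  rootLabel : LIMLabel G n

namespace LIMDD

/-- The number of nodes of a diagram, the leaf not counted. -/
def size {G : Subgroup (GL (Fin 2) ℂ)} {n : ℕ} (D : LIMDD G n) : ℕ :=
  ∑ k : Fin n, @Fintype.card (D.Node k.succ) (D.fintypeNode k.succ)

/-- The vector `|v⟩` of a node `v`: the leaf stands for the number `1`, and
`|v⟩ = |0⟩ ⊗ |low v⟩ + |1⟩ ⊗ |high v⟩` for the edges `low v` and `high v`. -/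
def nodeVec {G : Subgroup (GL (Fin 2) ℂ)} {n : ℕ} (D : LIMDD G n) :
    (k : ℕ) → (hk : k < n + 1) → D.Node ⟨k, hk⟩ → QVec k
  | 0, _, _ => fun _ => 1
  | k + 1, hk, v =>
    let j : Fin n := ⟨k, Nat.lt_of_succ_lt_succ hk⟩
    tensorTop (ket 0) ((D.lowLabel j v).apply
      (D.nodeVec k (Nat.lt_of_succ_lt hk) (D.low j v))) +
    tensorTop (ket 1) ((D.highLabel j v).apply
      (D.nodeVec k (Nat.lt_of_succ_lt hk) (D.high j v)))

/-- The vector represented by a diagram, that is, by its root edge. -/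
def vec {G : Subgroup (GL (Fin 2) ℂ)} {n : ℕ} (D : LIMDD G n) : QVec n :=
  D.rootLabel.apply (D.nodeVec n (Nat.lt_succ_self n) D.root)

end LIMDD

/-- The Pauli matrices `X`, `Y`, `Z`. -/
def pauliX : Matrix (Fin 2) (Fin 2) ℂ := !![0, 1; 1, 0]
def pauliY : Matrix (Fin 2) (Fin 2) ℂ := !![0, -Complex.I; Complex.I, 0]
def pauliZ : Matrix (Fin 2) (Fin 2) ℂ := !![1, 0; 0, -1]

/-- The one-qubit Pauli group, generated by `X`, `Y` and `Z`. Its elements are the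
matrices `I`, `X`, `Y`, `Z` times powers of `i`, so that the maps `c • Q_k ⊗ ⋯ ⊗ Q_1` with `c ≠ 0`
and `Q_j` in this group are exactly the nonzero multiples of Pauli strings. -/
def pauliGroup : Subgroup (GL (Fin 2) ℂ) :=
  Subgroup.closure {g | (g : Matrix (Fin 2) (Fin 2) ℂ) = pauliX ∨
    (g : Matrix (Fin 2) (Fin 2) ℂ) = pauliY ∨ (g : Matrix (Fin 2) (Fin 2) ℂ) = pauliZ}

/-- Pauli-LIMDDs. -/
abbrev PauliLIMDD (n : ℕ) := LIMDD pauliGroup n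

/-- QMDDs, the LIMDDs all of whose edge labels are scalars. -/
abbrev QMDD (n : ℕ) := LIMDD (⊥ : Subgroup (GL (Fin 2) ℂ)) n

/-! ### Stabilizer states -/

/-- The one-qubit operator `M` applied to qubit `j`. -/
def applyOne {n : ℕ} (M : Matrix (Fin 2) (Fin 2) ℂ) (j : Fin n) (ψ : QVec n) : QVec n :=
  fun x => ∑ b : Fin 2, M (x j) b * ψ (Function.update x j b)

/-- The controlled-NOT gate with control `c` and target `t`. -/
def applyCNOT {n : ℕ} (c t : Fin n) (ψ : QVec n) : QVec n :=
  fun x => ψ (Function.update x t (x t + x c))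

/-- The Hadamard gate, without its normalisation. -/
def hadamardGate : Matrix (Fin 2) (Fin 2) ℂ := !![1, 1; 1, -1]

/-- The phase gate. -/
def phaseGate : Matrix (Fin 2) (Fin 2) ℂ := !![1, 0; 0, Complex.I]

/-- Stabilizer states: outputs of circuits of Hadamard, phase and CNOT gates on input `|0…0⟩`,
up to a nonzero scalar. -/
inductive IsStabilizerState {n : ℕ} : QVec n → Prop
  | zero : IsStabilizerState (Pi.single 0 1)
  | hadamard (j : Fin n) {ψ : QVec n} :
      IsStabilizerState ψ → IsStabilizerState (applyOne hadamardGate j ψ)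
  | phase (j : Fin n) {ψ : QVec n} :
      IsStabilizerState ψ → IsStabilizerState (applyOne phaseGate j ψ)
  | cnot (c t : Fin n) (hct : c ≠ t) {ψ : QVec n} :
      IsStabilizerState ψ → IsStabilizerState (applyCNOT c t ψ)
  | smul (a : ℂ) (ha : a ≠ 0) {ψ : QVec n} :
      IsStabilizerState ψ → IsStabilizerState (a • ψ)

/-! ### Families of states -/

/-- A family of quantum states, the `i`-th one on `qubits i` qubits. -/
structure StateFamily where
  qubits : ℕ → ℕ
  state : ∀ i, QVec (qubits i)
  ne_zero : ∀ i, state i ≠ 0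

/-- The families of stabilizer states. -/
def stabilizerFamilies : Set StateFamily :=
  {F | ∀ i, IsStabilizerState (F.state i)}

/-- The families of states that have `G`-LIMDDs of size polynomial in the number of qubits, for
the given order of the qubits. -/
def polySizeFamilies (G : Subgroup (GL (Fin 2) ℂ)) : Set StateFamily :=
  {F | ∃ p : Polynomial ℕ, ∀ i, ∃ D : LIMDD G (F.qubits i),
    D.vec = F.state i ∧ D.size ≤ p.eval (F.qubits i)}

/-- The same, where the order of the qubits may be chosen for each state. -/
def polySizeAnyOrderFamilies (G : Subgroup (GL (Fin 2) ℂ)) : Set StateFamily :=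
  {F | ∃ p : Polynomial ℕ, ∀ i, ∃ (σ : Equiv.Perm (Fin (F.qubits i)))
    (D : LIMDD G (F.qubits i)),
    D.vec = permuteQubits σ (F.state i) ∧ D.size ≤ p.eval (F.qubits i)}

/-! ### Cluster states -/

/-- The graph state of `Γ`: the amplitude of `x` is `(-1) ^ e`, where `e` is the number of edges
of the subgraph induced by the vertices `v` with `x v = 1`. -/
noncomputable def graphState {m : ℕ} (Γ : SimpleGraph (Fin m)) : QVec m :=
  fun x => (-1) ^ {e ∈ Γ.edgeSet | ∀ v ∈ e, x v = 1}.ncard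

/-- The `n × n` grid, with its vertices numbered row by row. -/
def gridGraph (n : ℕ) : SimpleGraph (Fin (n * n)) :=
  ((SimpleGraph.pathGraph n).boxProd (SimpleGraph.pathGraph n)).comap finProdFinEquiv.symm

/-- The cluster state of the `n × n` grid. -/
noncomputable def clusterState (n : ℕ) : QVec (n * n) := graphState (gridGraph n)

/-- The state `(|0⟩ + e^{iπ/4} |1⟩) ⊗ |Gₙ⟩` with the cluster state `|Gₙ⟩`. -/
noncomputable def witnessState (n : ℕ) : QVec (n * n + 1) :=
  tensorTop (ket 0 + Complex.exp (Complex.I * (Real.pi / 4)) • ket 1) (clusterState n)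

/-!
For the inclusions, call a nonzero state *rigid* if every Pauli string `Z ^ b X ^ a` either has it
as an eigenvector or has expectation zero in it. The input `|0…0⟩` is rigid, and the Hadamard,
phase and CNOT gates conjugate Pauli strings to Pauli strings, so all stabilizer states are rigid
(`IsStabilizerState.isPauliRigid`). If `x` and `y` lie in the support of a rigid state, Fourier
inversion over `b` shows that some `Z ^ b X ^ (x + y)` stabilizes it up to a scalar
(`IsPauliRigid.exists_eigen`). Hence the two slices along the top qubit, if nonzero, are multiples
of Pauli images of one another, and each nonzero slice is rigid again (`IsPauliRigid.slice`). By
induction a stabilizer state has a Pauli-LIMDD with one node at each level. Moreover nonzero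
amplitudes of a rigid state have equal fourth powers (`IsPauliRigid.amplitude_pow_four`), which
excludes the ratio `e^{iπ/4}` between two amplitudes of the witness.

A graph state also has a diagram with one node at each level, since its slices along the last
vertex differ by `Z` on the neighbours of this vertex; a scalar label then accounts for the extra
qubit of the witness.

For the lower bound, restricting the vector of a QMDD by fixing all qubits above some level gives a
multiple of the vector of a node at that level, so there are at least as many nodes as pairwise
independent restrictions (`LIMDD.card_le_size`). An induced matching with `r` edges across the cut
provides `2 ^ r` of them (`two_pow_le_size_of_matching`). For any order of the grid vertices, cut
just before the first completion of a row or column: if this is a row, every column but one has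
vertices on both sides, hence an edge across the cut, and the edges from columns at distance at
least two form an induced matching (`exists_cut_matching`).
-/

/-! ### Pauli strings -/

/-- The sign `(-1) ^ (a b)` of two bits. -/
def bitSign (a b : Fin 2) : ℂ := if a = 1 ∧ b = 1 then -1 else 1

/-- The sign `(-1) ^ (b · x)` of two bit strings. -/
def pairing {n : ℕ} (b x : Fin n → Fin 2) : ℂ := ∏ i, bitSign (b i) (x i)

/-- The Pauli string `Z ^ b X ^ a`, without phase, applied to `ψ`. -/
def pauliString {n : ℕ} (a b : Fin n → Fin 2) (ψ : QVec n) : QVec n :=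
  fun x => pairing b x * ψ (x + a)

lemma bitSign_mul_self (a b : Fin 2) : bitSign a b * bitSign a b = 1 := by
  unfold bitSign; split_ifs <;> norm_num

lemma bitSign_comm (a b : Fin 2) : bitSign a b = bitSign b a := by
  simp [bitSign, and_comm]

lemma bitSign_add (a b c : Fin 2) : bitSign a (b + c) = bitSign a b * bitSign a c := by
  fin_cases a <;> fin_cases b <;> fin_cases c <;> simp [bitSign]

lemma bitSign_zero_right (a : Fin 2) : bitSign a 0 = 1 := by simp [bitSign]

lemma bitSign_zero_left (a : Fin 2) : bitSign 0 a = 1 := by simp [bitSign]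

lemma star_bitSign (a b : Fin 2) : star (bitSign a b) = bitSign a b := by
  unfold bitSign; split_ifs <;> simp

lemma bits_add_self {n : ℕ} (x : Fin n → Fin 2) : x + x = 0 := by
  funext i
  have : ∀ t : Fin 2, t + t = 0 := by decide
  exact this (x i)

section Pairing

variable {n : ℕ}

lemma pairing_mul_self (b x : Fin n → Fin 2) : pairing b x * pairing b x = 1 := by
  simp [pairing, ← Finset.prod_mul_distrib, bitSign_mul_self]

lemma pairing_ne_zero (b x : Fin n → Fin 2) : pairing b x ≠ 0 := by
  intro h
  simpa [h] using pairing_mul_self b x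

lemma pairing_comm (b x : Fin n → Fin 2) : pairing b x = pairing x b := by
  simp [pairing, bitSign_comm]

lemma pairing_add (b x y : Fin n → Fin 2) :
    pairing b (x + y) = pairing b x * pairing b y := by
  simp [pairing, ← Finset.prod_mul_distrib, bitSign_add]

lemma pairing_add_left (b c x : Fin n → Fin 2) :
    pairing (b + c) x = pairing b x * pairing c x := by
  rw [pairing_comm, pairing_add, pairing_comm x, pairing_comm x]

lemma pairing_single (b : Fin n → Fin 2) (j : Fin n) (t : Fin 2) :
    pairing b (Pi.single j t) = bitSign (b j) t := by
  rw [pairing, Finset.prod_eq_single j]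
  · simp
  · intro i _ hi
    simp [Pi.single_eq_of_ne hi, bitSign_zero_right]
  · simp

lemma pairing_single_left (b : Fin n → Fin 2) (j : Fin n) (t : Fin 2) :
    pairing (Pi.single j t) b = bitSign t (b j) := by
  rw [pairing_comm, pairing_single, bitSign_comm]

lemma star_pairing (b x : Fin n → Fin 2) : star (pairing b x) = pairing b x := by
  simp only [pairing, star_prod, star_bitSign]

lemma pairing_snoc (b x : Fin n → Fin 2) (r t : Fin 2) :
    pairing (Fin.snoc b r : Fin (n + 1) → Fin 2) (Fin.snoc x t) =
      pairing b x * bitSign r t := by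
  simp [pairing, Fin.prod_univ_castSucc]

lemma sum_pairing_mul_pairing (x y : Fin n → Fin 2) :
    ∑ b, pairing b x * pairing b y = if x = y then 2 ^ n else 0 := by
  have h : ∀ s t : Fin 2, ∑ c, bitSign c s * bitSign c t = if s = t then 2 else 0 := by
    intro s t
    fin_cases s <;> fin_cases t <;> norm_num [bitSign]
  calc ∑ b, pairing b x * pairing b y
      = ∑ b : Fin n → Fin 2, ∏ i, bitSign (b i) (x i) * bitSign (b i) (y i) := by
        simp [pairing, Finset.prod_mul_distrib]
    _ = ∏ i, ∑ c, bitSign c (x i) * bitSign c (y i) := by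
        rw [Finset.prod_univ_sum]; simp
    _ = if x = y then 2 ^ n else 0 := by
        simp only [h]
        split_ifs with hxy
        · simp [hxy]
        · obtain ⟨i, hi⟩ := Function.ne_iff.mp hxy
          exact Finset.prod_eq_zero (Finset.mem_univ i) (by simp [hi])

/-- A function on bit strings whose Fourier coefficients all vanish is zero. -/
lemma eq_zero_of_sum_pairing_eq_zero (f : (Fin n → Fin 2) → ℂ)
    (h : ∀ b, ∑ x, pairing b x * f x = 0) (y : Fin n → Fin 2) : f y = 0 := by
  have key : ∑ b, pairing b y * ∑ x, pairing b x * f x = 2 ^ n * f y := by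
    simp_rw [Finset.mul_sum]
    rw [Finset.sum_comm]
    simp_rw [← mul_assoc, ← Finset.sum_mul, sum_pairing_mul_pairing]
    simp
  simpa [h] using key.symm

lemma star_dotProduct_pauliString (a b : Fin n → Fin 2) (ψ φ : QVec n) :
    star (pauliString a b ψ) ⬝ᵥ pauliString a b φ = star ψ ⬝ᵥ φ := by
  simp only [dotProduct, Pi.star_apply, pauliString, star_mul', star_pairing]
  rw [← Equiv.sum_comp (Equiv.addRight a) (fun x => star (ψ x) * φ x)]
  refine Finset.sum_congr rfl fun x _ => ?_
  rw [Equiv.coe_addRight]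
  linear_combination (star (ψ (x + a)) * φ (x + a)) * pairing_mul_self b x

lemma pauliString_smul (a b : Fin n → Fin 2) (c : ℂ) (ψ : QVec n) :
    pauliString a b (c • ψ) = c • pauliString a b ψ := by
  funext x
  simp only [pauliString, Pi.smul_apply, smul_eq_mul]
  ring

lemma pauliString_zero_zero (ψ : QVec n) : pauliString 0 0 ψ = ψ := by
  funext x
  simp [pauliString, pairing, bitSign_zero_left]

/-- Two Pauli strings commute or anticommute. -/
lemma pauliString_comm (a b a' b' : Fin n → Fin 2) (ψ : QVec n) :
    pauliString a b (pauliString a' b' ψ) =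
      (pairing b' a * pairing b a') • pauliString a' b' (pauliString a b ψ) := by
  funext x
  simp only [pauliString, Pi.smul_apply, smul_eq_mul, pairing_add]
  rw [add_right_comm x a' a]
  linear_combination (-pairing b x * pairing b' x * pairing b' a * ψ (x + a + a')) *
    pairing_mul_self b a'

lemma pairing_eq_one_or (b x : Fin n → Fin 2) : pairing b x = 1 ∨ pairing b x = -1 :=
  mul_self_eq_one_iff.mp (pairing_mul_self b x)

end Pairing

/-! ### States whose Pauli strings are stabilizing or orthogonal -/

/-- Each Pauli string has the nonzero state `ψ` as an eigenvector or has expectation `0` in it.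
This is an intrinsic description of stabilizer states. -/
structure IsPauliRigid {n : ℕ} (ψ : QVec n) : Prop where
  ne_zero : ψ ≠ 0
  eigen_or_orthogonal : ∀ a b, (∃ c : ℂ, pauliString a b ψ = c • ψ) ∨
    star ψ ⬝ᵥ pauliString a b ψ = 0

namespace IsPauliRigid

variable {n : ℕ}

/-- By Fourier inversion over `b`, the strings `Z ^ b X ^ a` cannot all have expectation `0`
when `a` is the difference of two points of the support. -/
lemma exists_eigen {ψ : QVec n} (h : IsPauliRigid ψ) {x y : Fin n → Fin 2}
    (hx : ψ x ≠ 0) (hy : ψ y ≠ 0) :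
    ∃ b, ∃ c : ℂ, c ≠ 0 ∧ pauliString (x + y) b ψ = c • ψ := by
  by_contra! hne
  have hxy : x + (x + y) = y := by rw [← add_assoc, bits_add_self, zero_add]
  have h0 : ∀ b, ∑ z, pairing b z * (star (ψ z) * ψ (z + (x + y))) = 0 := by
    intro b
    rcases h.eigen_or_orthogonal (x + y) b with ⟨c, hc⟩ | ho
    · refine absurd hc (hne b c ?_)
      rintro rfl
      have := congrFun hc x
      simp [pauliString, hxy, pairing_ne_zero, hy] at this
    · rw [← ho]
      refine Finset.sum_congr rfl fun z _ => ?_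
      simp only [pauliString, Pi.star_apply]
      ring
  have := eq_zero_of_sum_pairing_eq_zero _ h0 x
  simp [hxy, hx, hy] at this

/-- Nonzero amplitudes of such a state differ by a power of `i`: a Pauli string squares to
`± 1`, so its eigenvalues are fourth roots of unity. -/
lemma amplitude_pow_four {ψ : QVec n} (h : IsPauliRigid ψ) {x y : Fin n → Fin 2}
    (hx : ψ x ≠ 0) (hy : ψ y ≠ 0) : ψ x ^ 4 = ψ y ^ 4 := by
  obtain ⟨b, c, -, hc⟩ := h.exists_eigen hx hy
  have e1 := congrFun hc x
  have e2 := congrFun hc y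
  have hxy : x + (x + y) = y := by rw [← add_assoc, bits_add_self, zero_add]
  have hyx : y + (x + y) = x := by rw [add_comm x y, ← add_assoc, bits_add_self, zero_add]
  simp only [pauliString, hxy, hyx, Pi.smul_apply, smul_eq_mul] at e1 e2
  have p4 : ∀ z, pairing b z ^ 2 = 1 := fun z => by rw [sq, pairing_mul_self]
  have q1 : ψ y ^ 2 = c ^ 2 * ψ x ^ 2 := by
    linear_combination (pairing b x * ψ y + c * ψ x) * e1 - ψ y ^ 2 * p4 x
  have q2 : ψ x ^ 2 = c ^ 2 * ψ y ^ 2 := by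
    linear_combination (pairing b y * ψ x + c * ψ y) * e2 - ψ x ^ 2 * p4 y
  linear_combination ψ x ^ 2 * q2 - ψ y ^ 2 * q1

end IsPauliRigid

/-! ### Clifford gates and Pauli strings -/

lemma star_dotProduct_self_ne_zero {n : ℕ} {ψ : QVec n} (h : ψ ≠ 0) : star ψ ⬝ᵥ ψ ≠ 0 := by
  open scoped ComplexOrder in exact mt dotProduct_star_self_eq_zero.mp h

section Gates

variable {n : ℕ}

/-- Rigidity passes through every operation that is unitary up to a scalar and conjugates Pauli
strings to Pauli strings. -/
lemma IsPauliRigid.map {ψ : QVec n} (h : IsPauliRigid ψ) (U : QVec n → QVec n) (k : ℂ)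
    (hk : k ≠ 0) (hsmul : ∀ (c : ℂ) φ, U (c • φ) = c • U φ)
    (hinner : ∀ φ φ', star (U φ) ⬝ᵥ U φ' = k * (star φ ⬝ᵥ φ'))
    (hconj : ∀ a b, ∃ a' b', ∃ s : ℂ, ∀ φ,
      pauliString a b (U φ) = s • U (pauliString a' b' φ)) :
    IsPauliRigid (U ψ) where
  ne_zero h0 := by
    have := hinner ψ ψ
    rw [h0, dotProduct_zero, eq_comm, mul_eq_zero] at this
    exact star_dotProduct_self_ne_zero h.ne_zero (this.resolve_left hk)
  eigen_or_orthogonal a b := by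
    obtain ⟨a', b', s, hs⟩ := hconj a b
    rw [hs]
    rcases h.eigen_or_orthogonal a' b' with ⟨c, hc⟩ | ho
    · exact Or.inl ⟨s * c, by rw [hc, hsmul, smul_smul]⟩
    · exact Or.inr (by rw [dotProduct_smul, hinner, ho]; simp)

lemma applyOne_smul (M : Matrix (Fin 2) (Fin 2) ℂ) (j : Fin n) (c : ℂ) (ψ : QVec n) :
    applyOne M j (c • ψ) = c • applyOne M j ψ := by
  funext x
  simp only [applyOne, Pi.smul_apply, smul_eq_mul, Finset.mul_sum]
  exact Finset.sum_congr rfl fun b _ => by ring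

lemma applyOne_applyOne (M N : Matrix (Fin 2) (Fin 2) ℂ) (j : Fin n) (ψ : QVec n) :
    applyOne M j (applyOne N j ψ) = applyOne (M * N) j ψ := by
  funext x
  simp only [applyOne, Fin.sum_univ_two, Matrix.mul_apply, Function.update_self,
    Function.update_idem]
  ring

lemma applyOne_scalar (k : ℂ) (j : Fin n) (ψ : QVec n) :
    applyOne (k • (1 : Matrix (Fin 2) (Fin 2) ℂ)) j ψ = k • ψ := by
  funext x
  simp [applyOne, Matrix.one_apply]

lemma star_applyOne_dotProduct (M : Matrix (Fin 2) (Fin 2) ℂ) (j : Fin n) (ψ φ : QVec n) :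
    star (applyOne M j ψ) ⬝ᵥ φ = star ψ ⬝ᵥ applyOne Mᴴ j φ := by
  simp only [dotProduct, applyOne, Pi.star_apply, star_sum, star_mul', Finset.sum_mul,
    Finset.mul_sum, Matrix.conjTranspose_apply]
  rw [← Fintype.sum_prod_type', ← Fintype.sum_prod_type']
  -- exchanging the free bit with bit `j` is an involution
  let f : (Fin n → Fin 2) × Fin 2 → (Fin n → Fin 2) × Fin 2 :=
    fun p => (Function.update p.1 j p.2, p.1 j)
  have hf : Function.Involutive f := fun p => by simp [f]
  refine Fintype.sum_equiv hf.toPerm _ _ fun p => ?_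
  simp [f]
  ring

lemma IsPauliRigid.applyOne {ψ : QVec n} (h : IsPauliRigid ψ) (M : Matrix (Fin 2) (Fin 2) ℂ)
    (j : Fin n) (k : ℂ) (hk : k ≠ 0) (hM : Mᴴ * M = k • 1)
    (hconj : ∀ a b, ∃ a' b', ∃ s : ℂ, ∀ φ,
      pauliString a b (applyOne M j φ) = s • _root_.applyOne M j (pauliString a' b' φ)) :
    IsPauliRigid (_root_.applyOne M j ψ) :=
  h.map _ k hk (applyOne_smul M j) (fun φ φ' => by
    rw [star_applyOne_dotProduct, applyOne_applyOne, hM, applyOne_scalar, dotProduct_smul,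
      smul_eq_mul]) hconj

lemma update_eq_add_single (b : Fin n → Fin 2) (j : Fin n) (r : Fin 2) :
    Function.update b j r = Function.update b j 0 + Pi.single j r := by
  funext i
  by_cases hi : i = j
  · subst hi; simp
  · simp [hi]

lemma pairing_update_update (b x : Fin n → Fin 2) (j : Fin n) (r t : Fin 2) :
    pairing (Function.update b j r) (Function.update x j t) =
      pairing (Function.update b j 0) x * bitSign r t := by
  rw [update_eq_add_single b j r, pairing_add_left, pairing_single_left, Function.update_self]
  congr 1
  refine Finset.prod_congr rfl fun i _ => ?_
  by_cases hi : i = j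
  · subst hi; simp [bitSign_zero_left]
  · simp [hi]

lemma pairing_eq_update (b x : Fin n → Fin 2) (j : Fin n) :
    pairing b x = pairing (Function.update b j 0) x * bitSign (b j) (x j) := by
  rw [← pairing_update_update, Function.update_eq_self, Function.update_eq_self]

lemma update_add_update (x a : Fin n → Fin 2) (j : Fin n) (s t : Fin 2) :
    Function.update x j s + Function.update a j t = Function.update (x + a) j (s + t) := by
  funext i
  by_cases hi : i = j
  · subst hi; simp
  · simp [hi]

/-- The Hadamard gate exchanges `X` and `Z`. -/
lemma IsPauliRigid.hadamard {ψ : QVec n} (h : IsPauliRigid ψ) (j : Fin n) :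
    IsPauliRigid (_root_.applyOne hadamardGate j ψ) := by
  refine h.applyOne _ j 2 two_ne_zero ?_ fun a b => ?_
  · ext i k
    fin_cases i <;> fin_cases k <;> simp [hadamardGate, Matrix.mul_apply] <;> norm_num
  refine ⟨Function.update a j (b j), Function.update b j (a j), bitSign (a j) (b j),
    fun φ => ?_⟩
  funext x
  simp only [pauliString, _root_.applyOne, Pi.smul_apply, smul_eq_mul, Fin.sum_univ_two,
    update_add_update, pairing_update_update, pairing_eq_update b x j, Pi.add_apply]
  generalize pairing (Function.update b j 0) x = p
  generalize hF : (fun t => φ (Function.update (x + a) j t)) = F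
  have hF' : ∀ t, φ (Function.update (x + a) j t) = F t := fun t => by rw [← hF]
  simp only [hF']
  generalize x j = u
  generalize a j = v
  generalize b j = w
  fin_cases u <;> fin_cases v <;> fin_cases w <;> simp [bitSign, hadamardGate] <;> ring

/-- The phase gate fixes `Z` and takes `X` to a multiple of `Z X`. -/
lemma IsPauliRigid.phase {ψ : QVec n} (h : IsPauliRigid ψ) (j : Fin n) :
    IsPauliRigid (_root_.applyOne phaseGate j ψ) := by
  refine h.applyOne _ j 1 one_ne_zero ?_ fun a b => ?_
  · ext i k
    fin_cases i <;> fin_cases k <;> simp [phaseGate, Matrix.mul_apply]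
  refine ⟨a, Function.update b j (b j + a j), if a j = 1 then Complex.I else 1, fun φ => ?_⟩
  have hdiag : ∀ (χ : QVec n) y, _root_.applyOne phaseGate j χ y =
      phaseGate (y j) (y j) * χ y := by
    intro χ y
    have h2 : ∀ t : Fin 2, y j = t → Function.update y j t = y := by
      rintro t rfl; exact Function.update_eq_self _ _
    have h3 : y j = 0 ∨ y j = 1 := by generalize y j = t; fin_cases t <;> simp
    rcases h3 with h3 | h3 <;>
      simp [_root_.applyOne, phaseGate, h3, h2 _ h3]
  funext x
  simp only [pauliString, hdiag, Pi.smul_apply, smul_eq_mul, pairing_eq_update b x j,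
    Pi.add_apply]
  have hp : pairing (Function.update b j (b j + a j)) x =
      pairing (Function.update b j 0) x * bitSign (b j + a j) (x j) := by
    rw [← pairing_update_update, Function.update_eq_self]
  rw [hp]
  generalize pairing (Function.update b j 0) x = p
  generalize φ (x + a) = F
  generalize x j = u
  generalize a j = v
  generalize b j = w
  fin_cases u <;> fin_cases v <;> fin_cases w <;> simp [bitSign, phaseGate] <;>
    first
    | ring1
    | (ring_nf; simp [Complex.I_sq])

lemma update_add_eq (x : Fin n → Fin 2) (t : Fin n) (s : Fin 2) :
    Function.update x t (x t + s) = x + Pi.single t s := by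
  funext i
  by_cases hi : i = t
  · subst hi; simp
  · simp [hi]

/-- The CNOT gate permutes the basis linearly, hence acts on both bit strings of `Z ^ b X ^ a`. -/
lemma IsPauliRigid.cnot {ψ : QVec n} (h : IsPauliRigid ψ) (c t : Fin n) (hct : c ≠ t) :
    IsPauliRigid (applyCNOT c t ψ) := by
  refine h.map _ 1 one_ne_zero (fun _ _ => rfl) (fun φ φ' => ?_) fun a b => ?_
  · have hinv : Function.Involutive
        (fun x : Fin n → Fin 2 => Function.update x t (x t + x c)) := by
      intro x
      have : ∀ u v : Fin 2, u + v + v = u := by decide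
      simp [Function.update_of_ne hct, this]
    rw [one_mul]
    exact Equiv.sum_comp hinv.toPerm (fun x => star (φ x) * φ' x)
  · refine ⟨a + Pi.single t (a c), b + Pi.single c (b t), 1, fun φ => ?_⟩
    funext x
    simp only [pauliString, applyCNOT, one_smul, update_add_eq,
      pairing_add, pairing_add_left, pairing_single, pairing_single_left]
    rw [Pi.add_apply b, Pi.single_eq_of_ne hct.symm, add_zero, mul_assoc (pairing b x),
      bitSign_mul_self, mul_one, Pi.add_apply x, Pi.single_add, add_add_add_comm]

end Gates

/-- Stabilizer states are rigid. -/
lemma IsStabilizerState.isPauliRigid {n : ℕ} {ψ : QVec n} (h : IsStabilizerState ψ) :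
    IsPauliRigid ψ := by
  induction h with
  | zero =>
    refine ⟨fun h0 => by simpa using congrFun h0 0, fun a b => ?_⟩
    by_cases ha : a = 0
    · left
      refine ⟨1, ?_⟩
      subst ha
      funext x
      by_cases hx : x = 0
      · subst hx; simp [pauliString, pairing, bitSign_zero_right]
      · simp [pauliString, hx]
    · right
      rw [dotProduct, Finset.sum_eq_zero]
      intro x _
      by_cases hx : x = 0
      · subst hx; simp [pauliString, ha]
      · simp [hx]
  | hadamard j _ ih => exact ih.hadamard j
  | phase j _ ih => exact ih.phase j
  | cnot c t hct _ ih => exact ih.cnot c t hct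
  | @smul a ha ψ _ ih =>
    refine ih.map (fun φ => a • φ) (star a * a) (mul_ne_zero (star_ne_zero.mpr ha) ha)
      (fun c φ => smul_comm _ _ _) (fun φ φ' => ?_) fun p q => ⟨p, q, 1, fun φ => ?_⟩
    · rw [star_smul, smul_dotProduct, dotProduct_smul]
      simp only [smul_eq_mul]
      ring
    · rw [one_smul, pauliString_smul]

/-! ### Tower diagrams -/

/-- The vectors represented by diagrams with one node at each level, the leaf included, whose root
edge has the trivial label. -/
inductive IsTowerState (G : Subgroup (GL (Fin 2) ℂ)) : ∀ {n : ℕ}, QVec n → Prop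
  | leaf : IsTowerState G (fun _ : Fin 0 → Fin 2 => 1)
  | node {n : ℕ} {φ : QVec n} (A B : LIMLabel G n) (h : IsTowerState G φ) :
      IsTowerState G (tensorTop (ket 0) (A.apply φ) + tensorTop (ket 1) (B.apply φ))

/-- The vector of the node at level `n` of the diagram with one node at each level and edge labels
`lo` and `hi`. -/
def towerVec {G : Subgroup (GL (Fin 2) ℂ)} (lo hi : ∀ k, LIMLabel G k) : ∀ n, QVec n
  | 0 => fun _ => 1
  | n + 1 => tensorTop (ket 0) ((lo n).apply (towerVec lo hi n)) +
      tensorTop (ket 1) ((hi n).apply (towerVec lo hi n))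

lemma towerVec_congr {G : Subgroup (GL (Fin 2) ℂ)} {lo hi lo' hi' : ∀ k, LIMLabel G k} :
    ∀ n, (∀ k < n, lo k = lo' k ∧ hi k = hi' k) → towerVec lo hi n = towerVec lo' hi' n
  | 0, _ => rfl
  | n + 1, h => by
    rw [towerVec, towerVec, towerVec_congr n fun k hk => h k (by omega),
      (h n (by omega)).1, (h n (by omega)).2]

lemma IsTowerState.exists_towerVec {G : Subgroup (GL (Fin 2) ℂ)} {n : ℕ} {φ : QVec n}
    (h : IsTowerState G φ) : ∃ lo hi : ∀ k, LIMLabel G k, towerVec lo hi n = φ := by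
  induction h with
  | leaf => exact ⟨fun _ => none, fun _ => none, rfl⟩
  | @node n φ A B _ ih =>
    obtain ⟨lo, hi, rfl⟩ := ih
    refine ⟨Function.update lo n A, Function.update hi n B, ?_⟩
    rw [towerVec, Function.update_self, Function.update_self,
      towerVec_congr (lo' := lo) (hi' := hi) n fun k hk => by simp [hk.ne]]

lemma IsTowerState.exists_limdd {G : Subgroup (GL (Fin 2) ℂ)} {n : ℕ} {φ : QVec n}
    (h : IsTowerState G φ) (A : LIMLabel G n) :
    ∃ D : LIMDD G n, D.vec = A.apply φ ∧ D.size = n := by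
  obtain ⟨lo, hi, rfl⟩ := h.exists_towerVec
  let D : LIMDD G n :=
    { Node := fun _ => Unit
      fintypeNode := fun _ => inferInstance
      leaf := inferInstance
      low := fun _ _ => ()
      high := fun _ _ => ()
      lowLabel := fun k _ => lo k
      highLabel := fun k _ => hi k
      root := ()
      rootLabel := A }
  refine ⟨D, ?_, by simp [LIMDD.size, D]⟩
  have key : ∀ (k : ℕ) (hk : k < n + 1), D.nodeVec k hk () = towerVec lo hi k := by
    intro k
    induction k with
    | zero => intro _; rfl
    | succ k ih =>
      intro hk
      rw [LIMDD.nodeVec, towerVec, ← ih (by omega)]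
  exact congrArg A.apply (key n (Nat.lt_succ_self n))

/-! ### Pauli strings as edge labels -/

/-- The matrix of `Z ^ b X ^ a`. -/
def pauliMatrix (a b : Fin 2) : Matrix (Fin 2) (Fin 2) ℂ :=
  fun x y => if y = x + a then bitSign b x else 0

lemma pauliX_mul_self : pauliX * pauliX = 1 := by
  ext i j
  fin_cases i <;> fin_cases j <;> simp [pauliX]

lemma pauliZ_mul_self : pauliZ * pauliZ = 1 := by
  ext i j
  fin_cases i <;> fin_cases j <;> simp [pauliZ]

lemma exists_pauliGroup_eq_pauliMatrix (a b : Fin 2) :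
    ∃ g : pauliGroup, ((g : GL (Fin 2) ℂ) : Matrix (Fin 2) (Fin 2) ℂ) = pauliMatrix a b := by
  let X : GL (Fin 2) ℂ := ⟨pauliX, pauliX, pauliX_mul_self, pauliX_mul_self⟩
  let Z : GL (Fin 2) ℂ := ⟨pauliZ, pauliZ, pauliZ_mul_self, pauliZ_mul_self⟩
  have hX : X ∈ pauliGroup := Subgroup.subset_closure (Or.inl rfl)
  have hZ : Z ∈ pauliGroup := Subgroup.subset_closure (Or.inr (Or.inr rfl))
  have h : pauliMatrix a b = ((Z ^ (b : ℕ) * X ^ (a : ℕ) : GL (Fin 2) ℂ) : Matrix _ _ ℂ) := by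
    have hXc : (X : Matrix (Fin 2) (Fin 2) ℂ) = pauliX := rfl
    have hZc : (Z : Matrix (Fin 2) (Fin 2) ℂ) = pauliZ := rfl
    ext i j
    fin_cases a <;> fin_cases b <;> fin_cases i <;> fin_cases j <;>
      simp [pauliMatrix, hXc, hZc, pauliX, pauliZ, bitSign]
  exact ⟨⟨_, mul_mem (pow_mem hZ _) (pow_mem hX _)⟩, h.symm⟩

lemma tensorOp_pauliMatrix_mulVec {n : ℕ} (a b : Fin n → Fin 2) (φ : QVec n) :
    tensorOp (fun j => pauliMatrix (a j) (b j)) *ᵥ φ = pauliString a b φ := by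
  funext x
  rw [Matrix.mulVec, dotProduct, Finset.sum_eq_single (x + a)]
  · simp [tensorOp, pauliMatrix, pauliString, pairing]
  · intro y _ hy
    obtain ⟨i, hi⟩ := Function.ne_iff.mp hy
    rw [tensorOp, Finset.prod_eq_zero (Finset.mem_univ i), zero_mul]
    exact if_neg hi
  · simp

/-- Every multiple of a Pauli string, zero included, is the action of an edge label. -/
lemma exists_label_apply_eq {n : ℕ} (c : ℂ) (a b : Fin n → Fin 2) :
    ∃ A : LIMLabel pauliGroup n, ∀ φ, A.apply φ = c • pauliString a b φ := by
  by_cases hc : c = 0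
  · exact ⟨none, fun φ => by simp [LIMLabel.apply, hc]⟩
  · choose g hg using exists_pauliGroup_eq_pauliMatrix
    refine ⟨some (Units.mk0 c hc, fun j => g (a j) (b j)), fun φ => ?_⟩
    simp only [LIMLabel.apply, hg, tensorOp_pauliMatrix_mulVec, Units.val_mk0]

lemma exists_label_apply_eq_smul {n : ℕ} (c : ℂ) :
    ∃ A : LIMLabel pauliGroup n, ∀ φ, A.apply φ = c • φ := by
  obtain ⟨A, hA⟩ := exists_label_apply_eq (n := n) c 0 0
  exact ⟨A, fun φ => by rw [hA, pauliString_zero_zero]⟩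

/-! ### Slices of a state -/

/-- The part of `ψ` in which the top qubit has the value `t`. -/
def slice {n : ℕ} (t : Fin 2) (ψ : QVec (n + 1)) : QVec n :=
  fun x => ψ (Fin.snoc x t)

section Slice

variable {n : ℕ}

lemma eq_tensorTop_of_slice {ψ : QVec (n + 1)} {φ₀ φ₁ : QVec n} (h₀ : slice 0 ψ = φ₀)
    (h₁ : slice 1 ψ = φ₁) : ψ = tensorTop (ket 0) φ₀ + tensorTop (ket 1) φ₁ := by
  subst h₀ h₁
  funext x
  obtain ⟨y, t, rfl⟩ : ∃ y t, x = (Fin.snoc y t : Fin (n + 1) → Fin 2) :=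
    ⟨_, _, (Fin.snoc_init_self x).symm⟩
  fin_cases t <;> simp [tensorTop, slice, ket]

lemma star_dotProduct_eq_slices (ψ φ : QVec (n + 1)) (u : Fin 2) :
    star ψ ⬝ᵥ φ = star (slice u ψ) ⬝ᵥ slice u φ +
      star (slice (u + 1) ψ) ⬝ᵥ slice (u + 1) φ := by
  have h : star ψ ⬝ᵥ φ = ∑ t, star (slice t ψ) ⬝ᵥ slice t φ := by
    simp only [dotProduct, slice, Pi.star_apply]
    rw [← Fintype.sum_prod_type']
    exact (Equiv.sum_comp (Fin.snocEquiv fun _ => Fin 2) fun x => star (ψ x) * φ x).symm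
  rw [h, Fin.sum_univ_two]
  fin_cases u
  · rfl
  · exact add_comm _ _

lemma snoc_add_snoc (x y : Fin n → Fin 2) (s t : Fin 2) :
    (Fin.snoc x s + Fin.snoc y t : Fin (n + 1) → Fin 2) = Fin.snoc (x + y) (s + t) := by
  funext i
  refine Fin.lastCases ?_ (fun i => ?_) i <;> simp

lemma slice_pauliString (a b : Fin n → Fin 2) (s r t : Fin 2) (ψ : QVec (n + 1)) :
    slice t (pauliString (Fin.snoc a s) (Fin.snoc b r) ψ) =
      bitSign r t • pauliString a b (slice (t + s) ψ) := by
  funext x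
  simp only [slice, pauliString, pairing_snoc, snoc_add_snoc, Pi.smul_apply, smul_eq_mul]
  ring

lemma slice_smul (t : Fin 2) (c : ℂ) (ψ : QVec (n + 1)) : slice t (c • ψ) = c • slice t ψ := rfl

namespace IsPauliRigid

/-- If one slice of a rigid state is nonzero, the other one is a multiple of its image under a
Pauli string. -/
lemma exists_slice_eq {ψ : QVec (n + 1)} (h : IsPauliRigid ψ) {u : Fin 2}
    (hu : slice u ψ ≠ 0) :
    ∃ (c : ℂ) (a b : Fin n → Fin 2), slice (u + 1) ψ = c • pauliString a b (slice u ψ) := by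
  by_cases hv : slice (u + 1) ψ = 0
  · exact ⟨0, 0, 0, by simp [hv]⟩
  obtain ⟨x, hx⟩ := Function.ne_iff.mp hu
  obtain ⟨y, hy⟩ := Function.ne_iff.mp hv
  obtain ⟨b, c, hc, hb⟩ := h.exists_eigen hx hy
  have hfin : u + (u + 1) = 1 ∧ u + 1 + 1 = u :=
    (by decide : ∀ t : Fin 2, t + (t + 1) = 1 ∧ t + 1 + 1 = t) u
  rw [snoc_add_snoc, hfin.1, ← Fin.snoc_init_self b] at hb
  have := congrArg (slice (u + 1)) hb
  rw [slice_pauliString, slice_smul, hfin.2] at this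
  exact ⟨c⁻¹ * bitSign _ (u + 1), x + y, Fin.init b, by
    rw [mul_smul, this, smul_smul, inv_mul_cancel₀ hc, one_smul]⟩

/-- A nonzero slice of a rigid state is rigid. The expectation of a Pauli string in the slice is
a nonzero multiple of its expectation in the state, after tensoring with `1` or `Z` on the
top qubit so that the contributions of the two slices do not cancel. -/
lemma slice {ψ : QVec (n + 1)} (h : IsPauliRigid ψ) {u : Fin 2} (hu : slice u ψ ≠ 0) :
    IsPauliRigid (slice u ψ) where
  ne_zero := hu
  eigen_or_orthogonal a b := by
    obtain ⟨c, a', b', hc⟩ := h.exists_slice_eq hu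
    -- the sign with which the two strings commute, realised by `Z` on the top qubit
    obtain ⟨r, hr⟩ : ∃ r : Fin 2,
        bitSign r u * bitSign r (u + 1) = pairing b' a * pairing b a' := by
      have hd : ∀ u : Fin 2, bitSign 1 u * bitSign 1 (u + 1) = -1 := by
        intro u; fin_cases u <;> simp [bitSign]
      rcases pairing_eq_one_or b' a with h1 | h1 <;> rcases pairing_eq_one_or b a' with h2 | h2
      · exact ⟨0, by simp [bitSign_zero_left, h1, h2]⟩
      · exact ⟨1, by simp [hd, h1, h2]⟩
      · exact ⟨1, by simp [hd, h1, h2]⟩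
      · exact ⟨0, by simp [bitSign_zero_left, h1, h2]⟩
    have hsl : ∀ t, _root_.slice t (pauliString (Fin.snoc a 0) (Fin.snoc b r) ψ) =
        bitSign r t • pauliString a b (_root_.slice t ψ) := fun t => by
      rw [slice_pauliString, add_zero]
    rcases h.eigen_or_orthogonal (Fin.snoc a 0) (Fin.snoc b r) with ⟨d, hd⟩ | ho
    · left
      have := congrArg (_root_.slice u) hd
      rw [hsl, slice_smul] at this
      exact ⟨bitSign r u * d, by rw [mul_smul, ← this, smul_smul, bitSign_mul_self, one_smul]⟩
    · right
      rw [star_dotProduct_eq_slices _ _ u, hsl, hsl, hc, pauliString_smul, pauliString_comm,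
        star_smul] at ho
      simp only [smul_dotProduct, dotProduct_smul, smul_eq_mul,
        star_dotProduct_pauliString, ← hr] at ho
      set e := star (_root_.slice u ψ) ⬝ᵥ pauliString a b (_root_.slice u ψ)
      have hpos : (1 + star c * c) ≠ 0 := by
        have h1 : (star c * c : ℂ) = ((Complex.normSq c : ℝ) : ℂ) := by
          rw [Complex.normSq_eq_conj_mul_self]; rfl
        rw [h1]
        have := Complex.normSq_nonneg c
        exact_mod_cast (by positivity : (1 + Complex.normSq c) ≠ 0)
      have hfac : bitSign r u * ((1 + star c * c) * e) = 0 := by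
        linear_combination ho -
          bitSign r u * star c * c * e * bitSign_mul_self r (u + 1)
      have hs : bitSign r u ≠ 0 := fun h0 => by simpa [h0] using bitSign_mul_self r u
      exact (mul_eq_zero.mp ((mul_eq_zero.mp hfac).resolve_left hs)).resolve_left hpos

end IsPauliRigid

end Slice

/-- A rigid state is a multiple of the vector of a tower of Pauli labels: both slices are multiples
of Pauli images of a rigid state on one qubit less. -/
lemma IsPauliRigid.exists_isTowerState : ∀ {n : ℕ} {ψ : QVec n}, IsPauliRigid ψ →
    ∃ (c : ℂ) (φ : QVec n), IsTowerState pauliGroup φ ∧ ψ = c • φ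
  | 0, ψ, _ => ⟨ψ 0, _, .leaf, by
      funext x
      simp [Subsingleton.elim x 0]⟩
  | n + 1, ψ, h => by
    by_cases h0 : _root_.slice 0 ψ = 0
    · have h1 : _root_.slice 1 ψ ≠ 0 := by
        intro h1
        apply h.ne_zero
        rw [eq_tensorTop_of_slice h0 h1]
        funext x
        simp [tensorTop]
      obtain ⟨c, φ, hφ, hc⟩ := (h.slice h1).exists_isTowerState
      obtain ⟨A, hA⟩ := exists_label_apply_eq_smul (n := n) 0
      obtain ⟨B, hB⟩ := exists_label_apply_eq_smul (n := n) 1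
      refine ⟨c, _, .node A B hφ, ?_⟩
      rw [eq_tensorTop_of_slice h0 hc, hA, hB]
      funext x
      simp [tensorTop]
      ring
    · obtain ⟨c, φ, hφ, hc⟩ := (h.slice h0).exists_isTowerState
      obtain ⟨d, a, b, hd⟩ := h.exists_slice_eq h0
      obtain ⟨A, hA⟩ := exists_label_apply_eq_smul (n := n) 1
      obtain ⟨B, hB⟩ := exists_label_apply_eq (n := n) d a b
      refine ⟨c, _, .node A B hφ, ?_⟩
      rw [zero_add, hc, pauliString_smul] at hd
      rw [eq_tensorTop_of_slice hc hd, hA, hB]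
      funext x
      simp [tensorTop]
      ring

/-- A stabilizer state has a Pauli-LIMDD with one node for each qubit. -/
lemma IsStabilizerState.exists_pauliLIMDD {n : ℕ} {ψ : QVec n} (h : IsStabilizerState ψ) :
    ∃ D : PauliLIMDD n, D.vec = ψ ∧ D.size = n := by
  obtain ⟨c, φ, hφ, rfl⟩ := h.isPauliRigid.exists_isTowerState
  obtain ⟨A, hA⟩ := exists_label_apply_eq_smul (n := n) c
  obtain ⟨D, hD, hs⟩ := hφ.exists_limdd A
  exact ⟨D, by rw [hD, hA], hs⟩

/-! ### Scalar labels -/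

lemma LIMLabel.exists_apply_bot_eq_smul {k : ℕ} (A : LIMLabel ⊥ k) :
    ∃ c : ℂ, ∀ φ, A.apply φ = c • φ := by
  match A with
  | none => exact ⟨0, fun φ => by simp [LIMLabel.apply]⟩
  | some (c, Q) =>
    refine ⟨c, fun φ => ?_⟩
    have hQ : ∀ j, ((Q j : GL (Fin 2) ℂ) : Matrix (Fin 2) (Fin 2) ℂ) = pauliMatrix 0 0 := by
      intro j
      rw [(Subgroup.mem_bot.mp (Q j).2 : (Q j : GL (Fin 2) ℂ) = 1)]
      ext x y
      simp [pauliMatrix, bitSign_zero_left, Matrix.one_apply, eq_comm]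
    simp only [LIMLabel.apply, hQ]
    congr 1
    exact (tensorOp_pauliMatrix_mulVec 0 0 φ).trans (pauliString_zero_zero φ)

/-- A diagram over a group is one over each larger group. -/
lemma LIMDD.exists_of_le {G H : Subgroup (GL (Fin 2) ℂ)} (hGH : G ≤ H) {n : ℕ}
    (D : LIMDD G n) : ∃ E : LIMDD H n, E.vec = D.vec ∧ E.size = D.size := by
  let f : ∀ {k}, LIMLabel G k → LIMLabel H k :=
    fun A => A.map fun p => (p.1, fun j => Subgroup.inclusion hGH (p.2 j))
  have hf : ∀ {k} (A : LIMLabel G k) φ, (f A).apply φ = A.apply φ := by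
    intro k A φ
    match A with
    | none => rfl
    | some (c, Q) => rfl
  let E : LIMDD H n :=
    { Node := D.Node
      fintypeNode := D.fintypeNode
      leaf := D.leaf
      low := D.low
      high := D.high
      lowLabel := fun k v => f (D.lowLabel k v)
      highLabel := fun k v => f (D.highLabel k v)
      root := D.root
      rootLabel := f D.rootLabel }
  have key : ∀ (k : ℕ) (hk : k < n + 1) v, E.nodeVec k hk v = D.nodeVec k hk v := by
    intro k
    induction k with
    | zero => intro _ _; rfl
    | succ k ih =>
      intro hk v
      rw [LIMDD.nodeVec, LIMDD.nodeVec]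
      simp only [ih]
      simp only [E, hf]
  refine ⟨E, ?_, rfl⟩
  rw [LIMDD.vec, key, LIMDD.vec]
  exact hf _ _

/-! ### Graph states -/

open Classical in
/-- The neighbourhood of the vertex `b` as a bit string. -/
noncomputable def neighborBits {m : ℕ} (Γ : SimpleGraph (Fin m)) (b : Fin m) : Fin m → Fin 2 :=
  fun u => if Γ.Adj b u then 1 else 0

section GraphState

variable {m : ℕ}

lemma graphState_ne_zero (Γ : SimpleGraph (Fin m)) (x : Fin m → Fin 2) :
    graphState Γ x ≠ 0 :=
  pow_ne_zero _ (by norm_num)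

lemma pairing_neighborBits (Γ : SimpleGraph (Fin m)) (b : Fin m) (x : Fin m → Fin 2) :
    pairing (neighborBits Γ b) x = (-1) ^ {u | Γ.Adj b u ∧ x u = 1}.ncard := by
  classical
  have h : ∀ u, bitSign (neighborBits Γ b u) (x u) =
      if Γ.Adj b u ∧ x u = 1 then -1 else 1 := by
    intro u
    by_cases hu : Γ.Adj b u <;> simp [bitSign, neighborBits, hu]
  rw [pairing, Finset.prod_congr rfl fun u _ => h u, Finset.prod_ite, Finset.prod_const,
    Finset.prod_const_one, mul_one, Set.ncard_eq_toFinset_card']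
  simp

/-- Switching on the bit `b` multiplies the amplitude by the sign of the number of neighbours of
`b` that are switched on. -/
lemma graphState_update (Γ : SimpleGraph (Fin m)) (x : Fin m → Fin 2) (b : Fin m)
    (hb : x b = 0) :
    graphState Γ (Function.update x b 1) = graphState Γ x * pairing (neighborBits Γ b) x := by
  have hset : {e ∈ Γ.edgeSet | ∀ v ∈ e, Function.update x b 1 v = 1} =
      {e ∈ Γ.edgeSet | ∀ v ∈ e, x v = 1} ∪
        (fun u => s(b, u)) '' {u | Γ.Adj b u ∧ x u = 1} := by
    ext e
    induction e using Sym2.ind with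
    | h p q =>
      simp only [Set.mem_ofPred_eq, SimpleGraph.mem_edgeSet, Sym2.mem_iff, forall_eq_or_imp,
        forall_eq, Set.mem_union, Set.mem_image, Sym2.eq_iff]
      constructor
      · rintro ⟨hpq, h1, h2⟩
        by_cases hp : p = b
        · subst hp
          have hq : q ≠ p := hpq.ne'
          rw [Function.update_of_ne hq] at h2
          exact Or.inr ⟨q, ⟨hpq, h2⟩, Or.inl ⟨rfl, rfl⟩⟩
        · rw [Function.update_of_ne hp] at h1
          by_cases hq : q = b
          · subst hq
            exact Or.inr ⟨p, ⟨hpq.symm, h1⟩, Or.inr ⟨rfl, rfl⟩⟩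
          · rw [Function.update_of_ne hq] at h2
            exact Or.inl ⟨hpq, h1, h2⟩
      · have aux : ∀ v, x v = 1 → Function.update x b 1 v = 1 := by
          intro v hv
          by_cases h : v = b
          · subst h; simp
          · rw [Function.update_of_ne h, hv]
        rintro (⟨hpq, h1, h2⟩ | ⟨u, ⟨hu, hx⟩, ⟨rfl, rfl⟩ | ⟨rfl, rfl⟩⟩)
        · exact ⟨hpq, aux _ h1, aux _ h2⟩
        · exact ⟨hu, by simp, aux _ hx⟩
        · exact ⟨hu.symm, aux _ hx, by simp⟩
  have hdisj : Disjoint {e ∈ Γ.edgeSet | ∀ v ∈ e, x v = 1}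
      ((fun u => s(b, u)) '' {u | Γ.Adj b u ∧ x u = 1}) := by
    rw [Set.disjoint_left]
    rintro _ ⟨-, h⟩ ⟨u, -, rfl⟩
    have := h b (by simp)
    simp [hb] at this
  have hinj : Function.Injective (fun u => s(b, u)) := fun u v h => Sym2.congr_right.mp h
  rw [graphState, hset, Set.ncard_union_eq hdisj (Set.toFinite _) (Set.toFinite _),
    Set.ncard_image_of_injective _ hinj, pow_add, pairing_neighborBits, graphState]

/-- Switching off the last vertex gives the graph state of the other vertices. -/
lemma graphState_snoc_zero (Γ : SimpleGraph (Fin (m + 1))) (y : Fin m → Fin 2) :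
    graphState Γ (Fin.snoc y 0) = graphState (Γ.comap Fin.castSucc) y := by
  have hset : {e ∈ Γ.edgeSet | ∀ v ∈ e, (Fin.snoc y 0 : Fin (m + 1) → Fin 2) v = 1} =
      Sym2.map Fin.castSucc '' {e ∈ (Γ.comap Fin.castSucc).edgeSet | ∀ v ∈ e, y v = 1} := by
    ext e
    constructor
    · induction e using Sym2.ind with
      | h p q =>
        simp only [Set.mem_ofPred_eq, SimpleGraph.mem_edgeSet, Sym2.mem_iff, forall_eq_or_imp,
          forall_eq]
        rintro ⟨hpq, h1, h2⟩
        induction p using Fin.lastCases with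
        | last => simp at h1
        | cast p =>
          induction q using Fin.lastCases with
          | last => simp at h2
          | cast q =>
            rw [Fin.snoc_castSucc] at h1 h2
            exact ⟨s(p, q), ⟨hpq, by simp [h1, h2]⟩, rfl⟩
    · rintro ⟨e, ⟨he, h⟩, rfl⟩
      induction e using Sym2.ind with
      | h p q =>
        have h1 := h p (by simp)
        have h2 := h q (by simp)
        exact ⟨he, by simp [h1, h2]⟩
  rw [graphState, hset, Set.ncard_image_of_injective _
    (Sym2.map.injective (Fin.castSucc_injective m)), graphState]

/-- The lower node of a graph state serves for both values of the top qubit, the two edges differing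
by `Z` on the neighbours of the last vertex. -/
lemma isTowerState_graphState : ∀ {m : ℕ} (Γ : SimpleGraph (Fin m)),
    IsTowerState pauliGroup (graphState Γ)
  | 0, Γ => by
    have : graphState Γ = fun _ => 1 := by
      funext x
      have hE : {e ∈ Γ.edgeSet | ∀ v ∈ e, x v = 1} = ∅ := by
        ext e
        induction e using Sym2.ind with
        | h p q => exact p.elim0
      rw [graphState, hE, Set.ncard_empty, pow_zero]
    rw [this]
    exact .leaf
  | m + 1, Γ => by
    obtain ⟨A, hA⟩ := exists_label_apply_eq_smul (n := m) 1
    obtain ⟨B, hB⟩ := exists_label_apply_eq (n := m) 1 0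
      (fun i => neighborBits Γ (Fin.last m) i.castSucc)
    have := IsTowerState.node A B (isTowerState_graphState (Γ.comap Fin.castSucc))
    rwa [← eq_tensorTop_of_slice (ψ := graphState Γ)] at this
    · rw [hA, one_smul]
      funext y
      exact graphState_snoc_zero Γ y
    · rw [hB, one_smul]
      funext y
      have hs : (Fin.snoc y 1 : Fin (m + 1) → Fin 2) =
          Function.update (Fin.snoc y 0) (Fin.last m) 1 :=
        (Fin.update_snoc_last _ _ _).symm
      have hN : neighborBits Γ (Fin.last m) =
          Fin.snoc (fun i => neighborBits Γ (Fin.last m) i.castSucc) 0 := by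
        funext i
        refine Fin.lastCases ?_ (fun i => ?_) i <;> simp [neighborBits]
      rw [slice, hs, graphState_update _ _ _ (by simp), graphState_snoc_zero, hN, pairing_snoc,
        bitSign_zero_right, mul_one, pauliString, add_zero, mul_comm]
      simp

end GraphState

/-! ### A lower bound for the size of QMDDs -/

namespace LIMDD

variable {N : ℕ}

/-- Fixing the values of the qubits above level `k` selects a node of level `k` that represents,
up to a scalar, the remaining function of the qubits below. -/
lemma exists_vec_eq_mul_nodeVec (D : QMDD N) (z : Fin N → Fin 2) :
    ∀ (d k : ℕ) (hk : k < N + 1), k + d = N → ∃ (v : D.Node ⟨k, hk⟩) (c : ℂ),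
      ∀ z' : Fin N → Fin 2, (∀ j : Fin N, k ≤ j → z' j = z j) →
        D.vec z' = c * D.nodeVec k hk v (fun i => z' (Fin.castLE (Nat.le_of_lt_succ hk) i))
  | 0, k, hk, hd => by
    obtain rfl : k = N := by omega
    obtain ⟨c, hc⟩ := D.rootLabel.exists_apply_bot_eq_smul
    exact ⟨D.root, c, fun z' _ => by rw [LIMDD.vec, hc]; rfl⟩
  | d + 1, k, hk, hd => by
    obtain ⟨v, c, h⟩ := D.exists_vec_eq_mul_nodeVec z d (k + 1) (by omega) (by omega)
    let j : Fin N := ⟨k, by omega⟩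
    have hnode : ∀ z' : Fin N → Fin 2, D.nodeVec (k + 1) (by omega) v
        (fun i => z' (Fin.castLE (by omega) i)) =
        ket 0 (z' j) * (D.lowLabel j v).apply (D.nodeVec k hk (D.low j v))
          (fun i => z' (Fin.castLE (by omega) i)) +
        ket 1 (z' j) * (D.highLabel j v).apply (D.nodeVec k hk (D.high j v))
          (fun i => z' (Fin.castLE (by omega) i)) := fun z' => rfl
    rcases (by generalize z j = t; fin_cases t <;> simp : z j = 0 ∨ z j = 1) with hz | hz
    · obtain ⟨e, he⟩ := (D.lowLabel j v).exists_apply_bot_eq_smul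
      refine ⟨D.low j v, c * e, fun z' hz' => ?_⟩
      rw [h z' fun i hi => hz' i (by omega), hnode, hz' j le_rfl, hz, he]
      rw [ket, ket, Pi.single_eq_same, Pi.single_eq_of_ne (by decide), one_mul, zero_mul,
        add_zero, mul_assoc]
      rfl
    · obtain ⟨e, he⟩ := (D.highLabel j v).exists_apply_bot_eq_smul
      refine ⟨D.high j v, c * e, fun z' hz' => ?_⟩
      rw [h z' fun i hi => hz' i (by omega), hnode, hz' j le_rfl, hz, he]
      rw [ket, ket, Pi.single_eq_same, Pi.single_eq_of_ne (by decide), one_mul, zero_mul,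
        zero_add, mul_assoc]
      rfl

lemma card_node_le_size {G : Subgroup (GL (Fin 2) ℂ)} (D : LIMDD G N) (k : Fin N) :
    @Fintype.card (D.Node k.succ) (D.fintypeNode k.succ) ≤ D.size :=
  Finset.single_le_sum (f := fun k : Fin N =>
    @Fintype.card (D.Node k.succ) (D.fintypeNode k.succ)) (fun _ _ => Nat.zero_le _)
    (Finset.mem_univ k)

lemma one_le_size {G : Subgroup (GL (Fin 2) ℂ)} (D : LIMDD G (N + 1)) : 1 ≤ D.size := by
  refine le_trans ?_ (D.card_node_le_size (Fin.last N))
  let := D.fintypeNode (Fin.last N).succ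
  exact Fintype.card_pos_iff.mpr ⟨D.root⟩

/-- Assignments of the qubits above level `k` whose restrictions of the represented vector are
pairwise linearly independent lead to distinct nodes of level `k`. -/
lemma card_le_size {ι : Type*} [Fintype ι] (D : QMDD N) (k : ℕ) (hk0 : 0 < k) (hk : k ≤ N)
    (z : ι → Fin N → Fin 2) (hz : ∀ i (j : Fin N), j < k → z i j = 0)
    (hne : ∀ i i', i ≠ i' → ∃ w w' : Fin N → Fin 2,
      (∀ j : Fin N, k ≤ j → w j = 0 ∧ w' j = 0) ∧
      D.vec (z i + w) * D.vec (z i' + w') ≠ D.vec (z i + w') * D.vec (z i' + w)) :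
    Fintype.card ι ≤ D.size := by
  obtain ⟨k, rfl⟩ : ∃ l, k = l + 1 := ⟨k - 1, by omega⟩
  choose v c hv using fun i =>
    D.exists_vec_eq_mul_nodeVec (z i) (N - (k + 1)) (k + 1) (by omega) (by omega)
  let : Fintype (D.Node ⟨k + 1, Nat.lt_succ_of_le hk⟩) := D.fintypeNode _
  refine le_trans (Fintype.card_le_of_injective v fun i i' hii => ?_)
    (D.card_node_le_size ⟨k, hk⟩)
  by_contra hn
  obtain ⟨w, w', hw, h⟩ := hne i i' hn
  have hval : ∀ i w, (∀ j : Fin N, k + 1 ≤ j → w j = 0) → D.vec (z i + w) =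
      c i * D.nodeVec (k + 1) (by omega) (v i) (fun l => w (Fin.castLE hk l)) := by
    intro i w hw
    rw [hv i (z i + w) fun j hj => by rw [Pi.add_apply, hw j hj, add_zero]]
    congr 2
    funext l
    rw [Pi.add_apply, hz i _ l.isLt, zero_add]
  rw [hval i w fun j hj => (hw j hj).1, hval i w' fun j hj => (hw j hj).2,
    hval i' w fun j hj => (hw j hj).1, hval i' w' fun j hj => (hw j hj).2, hii] at h
  exact h (by ring)

end LIMDD

lemma pairing_sum_single {m r : ℕ} (b : Fin m → Fin 2) (a : Fin r → Fin m)
    (y : Fin r → Fin 2) :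
    pairing b (∑ i, Pi.single (a i) (y i)) = ∏ i, bitSign (b (a i)) (y i) := by
  have h : ∀ s : Finset (Fin r), pairing b (∑ i ∈ s, Pi.single (a i) (y i)) =
      ∏ i ∈ s, bitSign (b (a i)) (y i) := by
    intro s
    induction s using Finset.cons_induction with
    | empty => simp [pairing, bitSign_zero_right]
    | cons i s hi ih =>
      rw [Finset.sum_cons, Finset.prod_cons, pairing_add, pairing_single, ih]
  exact h _

/-- An induced matching across a cut of the qubit order, with `r` edges, forces `2 ^ r` nodes:
the bits of the upper ends `a i` are visible as the signs that the lower ends `b i` acquire. -/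
lemma two_pow_le_size_of_matching {m r : ℕ} (Γ : SimpleGraph (Fin m)) (α : Fin 2 → ℂ)
    (hα : α 0 ≠ 0) (σ : Equiv.Perm (Fin (m + 1))) (D : QMDD (m + 1))
    (hD : D.vec = permuteQubits σ (tensorTop α (graphState Γ))) (k : ℕ) (hk : k ≤ m + 1)
    (a b : Fin r → Fin m) (ha : ∀ i, k ≤ (σ (a i).castSucc : ℕ))
    (hb : ∀ i, (σ (b i).castSucc : ℕ) < k) (hadj : ∀ i j, Γ.Adj (b j) (a i) ↔ i = j) :
    2 ^ r ≤ D.size := by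
  rcases Nat.eq_zero_or_pos r with rfl | hr
  · exact D.one_le_size
  have hk0 : 0 < k := lt_of_le_of_lt (Nat.zero_le _) (hb ⟨0, hr⟩)
  let Z : (Fin r → Fin 2) → Fin m → Fin 2 := fun y => ∑ i, Pi.single (a i) (y i)
  let e : (Fin m → Fin 2) → Fin (m + 1) → Fin 2 :=
    fun x => (Fin.snoc x 0 : Fin (m + 1) → Fin 2) ∘ σ.symm
  have hZ : ∀ y u, (∀ i, u ≠ a i) → Z y u = 0 := by
    intro y u hu
    simp only [Z, Finset.sum_apply]
    exact Finset.sum_eq_zero fun i _ => Pi.single_eq_of_ne (hu i) _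
  have hval : ∀ x x', D.vec (e x + e x') = α 0 * graphState Γ (x + x') := by
    intro x x'
    have : (e x + e x') ∘ σ = (Fin.snoc (x + x') 0 : Fin (m + 1) → Fin 2) := by
      rw [← add_zero (0 : Fin 2), ← snoc_add_snoc]
      funext i
      simp [e]
    rw [hD, permuteQubits, this]
    simp [tensorTop]
  -- a bit string with no bit on the wrong side of the cut stays so in the order `σ`
  have hside : ∀ (x : Fin m → Fin 2) (j : Fin (m + 1)),
      (∀ u, σ u.castSucc = j → x u = 0) → e x j = 0 := by
    intro x j h
    obtain ⟨i, rfl⟩ := σ.surjective j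
    simp only [e, Function.comp_apply, Equiv.symm_apply_apply]
    induction i using Fin.lastCases with
    | last => simp
    | cast u => rw [Fin.snoc_castSucc]; exact h u rfl
  have hab : ∀ i j, b j ≠ a i := fun i j h => by
    have h1 := ha i
    have h2 := hb j
    rw [h] at h2
    omega
  have hcard := D.card_le_size k hk0 hk (fun y => e (Z y)) (fun y j hj => ?_) fun y y' hy => ?_
  · simpa using hcard
  · refine hside _ _ fun u hu => hZ y u fun i hi => ?_
    have := ha i
    rw [← hi, hu] at this
    omega
  · obtain ⟨j, hj⟩ := Function.ne_iff.mp hy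
    refine ⟨e 0, e (Pi.single (b j) 1), fun l hl => ⟨hside _ _ fun _ _ => rfl,
      hside _ _ fun u hu => Pi.single_eq_of_ne (fun h => ?_) _⟩, ?_⟩
    · have := hb j
      rw [← h, hu] at this
      omega
    · have hflip : ∀ y, graphState Γ (Z y + Pi.single (b j) 1) =
          graphState Γ (Z y) * bitSign 1 (y j) := by
        intro y
        have h0 : Z y (b j) = 0 := hZ y _ fun i => hab i j
        have hu : Z y + Pi.single (b j) 1 = Function.update (Z y) (b j) 1 := by
          rw [← update_add_eq, h0, zero_add]
        rw [hu, graphState_update _ _ _ h0, pairing_sum_single, Finset.prod_eq_single j]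
        · simp [neighborBits, (hadj j j).mpr rfl]
        · intro i _ hi
          simp [neighborBits, hadj, hi, bitSign_zero_left]
        · simp
      have hs : bitSign 1 (y j) ≠ bitSign 1 (y' j) := by
        revert hj
        generalize y j = s
        generalize y' j = t
        intro hst
        fin_cases s <;> fin_cases t <;> simp [bitSign] at hst ⊢ <;> norm_num
      simp only [hval, add_zero, hflip]
      intro h
      have hprod : α 0 * graphState Γ (Z y) * (α 0 * graphState Γ (Z y')) ≠ 0 :=
        mul_ne_zero (mul_ne_zero hα (graphState_ne_zero _ _))
          (mul_ne_zero hα (graphState_ne_zero _ _))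
      exact hs (mul_left_cancel₀ hprod (by linear_combination -h))

/-! ### Induced matchings across cuts of the grid -/

/-- If a set of grid vertices contains a row but for one vertex and contains no column, then all
columns but one have an edge with one end in the set; columns at distance at least two give an
induced matching. -/
lemma exists_matching_of_row {n r : ℕ} (hn : 2 * r < n) (P : Fin n × Fin n → Prop)
    (row c₀ : Fin n) (hrow : ∀ c, c ≠ c₀ → P (row, c)) (hcol : ∀ c, ∃ q, ¬ P (q, c)) :
    ∃ a b : Fin r → Fin n × Fin n, (∀ i, ¬ P (a i)) ∧ (∀ i, P (b i)) ∧
      ∀ i j, ((SimpleGraph.pathGraph n).boxProd (SimpleGraph.pathGraph n)).Adj (b j) (a i) ↔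
        i = j := by
  have hcross : ∀ c, c ≠ c₀ → ∃ p q, (SimpleGraph.pathGraph n).Adj p q ∧ P (p, c) ∧
      ¬ P (q, c) := by
    intro c hc
    obtain ⟨q, hq⟩ := hcol c
    obtain ⟨w⟩ := SimpleGraph.pathGraph_preconnected n row q
    obtain ⟨d, -, h1, h2⟩ := w.exists_boundary_dart {s | P (s, c)} (hrow c hc) hq
    exact ⟨_, _, d.adj, h1, h2⟩
  -- the even columns, shifted by two from the exceptional column on
  let c : Fin r → Fin n := fun i =>
    ⟨if 2 * (i : ℕ) < c₀ then 2 * i else 2 * i + 2, by split_ifs <;> omega⟩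
  have hc₀ : ∀ i, c i ≠ c₀ := by
    intro i h
    have := congrArg Fin.val h
    simp only [c] at this
    split_ifs at this <;> omega
  have hgap : ∀ i j, i < j → (c i : ℕ) + 2 ≤ c j := by
    intro i j hij
    have : (i : ℕ) < j := hij
    simp only [c]
    split_ifs <;> omega
  choose p q hpq hp hq using fun i => hcross (c i) (hc₀ i)
  refine ⟨fun i => (q i, c i), fun i => (p i, c i), hq, hp, fun i j => ?_⟩
  rw [SimpleGraph.boxProd_adj]
  constructor
  · intro h
    by_contra hij
    have h2 : (c i : ℕ) + 2 ≤ c j ∨ (c j : ℕ) + 2 ≤ c i := by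
      rcases lt_or_gt_of_ne hij with h | h
      · exact Or.inl (hgap _ _ h)
      · exact Or.inr (hgap _ _ h)
    rcases h with ⟨-, h⟩ | ⟨h, -⟩
    · have := congrArg Fin.val h
      simp only at this
      omega
    · rw [SimpleGraph.pathGraph_adj] at h
      simp only at h
      omega
  · rintro rfl
    exact Or.inl ⟨hpq i, rfl⟩

/-- In every injective placement of the grid vertices there is a cut with an induced matching: take
the last moment before a row or a column is completed. -/
lemma exists_cut_matching {n r M : ℕ} (hn : 2 * r < n) (pos : Fin n × Fin n → ℕ)
    (hpos : Function.Injective pos) (hM : ∀ v, pos v < M) :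
    ∃ k ≤ M, ∃ a b : Fin r → Fin n × Fin n, (∀ i, k ≤ pos (a i)) ∧ (∀ i, pos (b i) < k) ∧
      ∀ i j, ((SimpleGraph.pathGraph n).boxProd (SimpleGraph.pathGraph n)).Adj (b j) (a i) ↔
        i = j := by
  classical
  let full : ℕ → Prop := fun k =>
    (∃ p, ∀ c, pos (p, c) < k) ∨ (∃ c, ∀ p, pos (p, c) < k)
  have o : Fin n := ⟨0, by omega⟩
  have hex : ∃ k, full k := ⟨M, Or.inl ⟨o, fun c => hM _⟩⟩
  have hle : Nat.find hex ≤ M := Nat.find_min' hex (Or.inl ⟨o, fun c => hM _⟩)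
  obtain ⟨k, hk⟩ : ∃ k, Nat.find hex = k + 1 := by
    refine Nat.exists_eq_succ_of_ne_zero fun h0 => ?_
    have := Nat.find_spec hex
    rw [h0] at this
    rcases this with ⟨p, h⟩ | ⟨p, h⟩ <;> exact absurd (h o) (Nat.not_lt_zero _)
  have hfull : full (k + 1) := hk ▸ Nat.find_spec hex
  have hnot : ¬ full k := Nat.find_min hex (by omega)
  simp only [full, not_or, not_exists, not_forall] at hnot
  -- at most one vertex of a completed line is placed last
  have hone : ∀ f : Fin n → Fin n × Fin n, Function.Injective f →
      (∀ c, pos (f c) < k + 1) → ∃ c₀, ∀ c, c ≠ c₀ → pos (f c) < k := by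
    intro f hf h
    by_cases hall : ∃ c₀, pos (f c₀) = k
    · obtain ⟨c₀, h₀⟩ := hall
      refine ⟨c₀, fun c hc => lt_of_le_of_ne (Nat.lt_succ_iff.mp (h c)) fun he => hc ?_⟩
      exact hf (hpos (he.trans h₀.symm))
    · push Not at hall
      exact ⟨o, fun c _ => lt_of_le_of_ne (Nat.lt_succ_iff.mp (h c)) (hall c)⟩
  refine ⟨k, by omega, ?_⟩
  rcases hfull with ⟨p, hp⟩ | ⟨c, hc⟩
  · obtain ⟨c₀, h₀⟩ := hone (fun c => (p, c)) (fun _ _ h => (Prod.mk.inj h).2) hp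
    obtain ⟨a, b, ha, hb, hab⟩ :=
      exists_matching_of_row hn (fun v => pos v < k) p c₀ h₀ hnot.2
    exact ⟨a, b, fun i => not_lt.mp (ha i), hb, hab⟩
  · obtain ⟨c₀, h₀⟩ := hone (fun p => (p, c)) (fun _ _ h => (Prod.mk.inj h).1) hc
    obtain ⟨a, b, ha, hb, hab⟩ :=
      exists_matching_of_row hn (fun v => pos v.swap < k) c c₀ h₀ hnot.1
    refine ⟨fun i => (a i).swap, fun i => (b i).swap, fun i => not_lt.mp (ha i), hb,
      fun i j => ?_⟩
    rw [← hab i j, SimpleGraph.boxProd_adj, SimpleGraph.boxProd_adj, or_comm]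
    rfl

/-! ### The witness states -/

lemma tensorTop_snoc {n : ℕ} (α : Fin 2 → ℂ) (φ : QVec n) (y : Fin n → Fin 2) (t : Fin 2) :
    tensorTop α φ (Fin.snoc y t) = α t * φ y := by
  simp [tensorTop]

lemma exp_I_mul_pi_div_four_pow_four :
    Complex.exp (Complex.I * (Real.pi / 4)) ^ 4 = -1 := by
  rw [← Complex.exp_nat_mul, ← Complex.exp_pi_mul_I]
  congr 1
  push_cast
  ring

lemma witnessState_snoc_zero (n : ℕ) (y : Fin (n * n) → Fin 2) :
    witnessState n (Fin.snoc y 0) = clusterState n y := by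
  simp [witnessState, tensorTop_snoc, ket]

lemma witnessState_snoc_one (n : ℕ) (y : Fin (n * n) → Fin 2) :
    witnessState n (Fin.snoc y 1) =
      Complex.exp (Complex.I * (Real.pi / 4)) * clusterState n y := by
  simp [witnessState, tensorTop_snoc, ket]

lemma witnessState_ne_zero (n : ℕ) : witnessState n ≠ 0 := fun h =>
  graphState_ne_zero (gridGraph n) 0 <| by
    rw [← clusterState, ← witnessState_snoc_zero, h, Pi.zero_apply]

lemma not_isStabilizerState_witnessState (n : ℕ) : ¬ IsStabilizerState (witnessState n) := by
  intro h
  have hg : clusterState n 0 ≠ 0 := graphState_ne_zero _ _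
  have h0 := witnessState_snoc_zero n 0
  have h1 := witnessState_snoc_one n 0
  have := h.isPauliRigid.amplitude_pow_four (x := Fin.snoc 0 0) (y := Fin.snoc 0 1)
    (by rwa [h0]) (by rw [h1]; exact mul_ne_zero (Complex.exp_ne_zero _) hg)
  rw [h0, h1, mul_pow, exp_I_mul_pi_div_four_pow_four] at this
  exact pow_ne_zero 4 hg (by linear_combination this / 2)

lemma exists_pauliLIMDD_witnessState (n : ℕ) :
    ∃ D : PauliLIMDD (n * n + 1), D.vec = witnessState n ∧ D.size ≤ n * n + 1 := by
  obtain ⟨A, hA⟩ := exists_label_apply_eq_smul (n := n * n) 1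
  obtain ⟨B, hB⟩ :=
    exists_label_apply_eq_smul (n := n * n) (Complex.exp (Complex.I * (Real.pi / 4)))
  obtain ⟨E, hE⟩ := exists_label_apply_eq_smul (n := n * n + 1) 1
  have h := IsTowerState.node A B (isTowerState_graphState (gridGraph n))
  rw [← eq_tensorTop_of_slice (ψ := witnessState n)] at h
  · obtain ⟨D, hD, hs⟩ := h.exists_limdd E
    exact ⟨D, by rw [hD, hE, one_smul], hs.le⟩
  · rw [hA, one_smul]
    funext y
    exact witnessState_snoc_zero n y
  · rw [hB]
    funext y
    exact witnessState_snoc_one n y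

lemma two_pow_le_size_of_vec_eq_witnessState (n : ℕ) (σ : Equiv.Perm (Fin (n * n + 1)))
    (D : QMDD (n * n + 1)) (hD : D.vec = permuteQubits σ (witnessState n)) :
    2 ^ (n / 12) ≤ D.size := by
  rcases Nat.eq_zero_or_pos n with rfl | hn
  · exact D.one_le_size
  obtain ⟨k, hk, a, b, ha, hb, hab⟩ := exists_cut_matching (n := n) (r := n / 12)
    (M := n * n + 1) (by omega) (fun v => (σ (finProdFinEquiv v).castSucc : ℕ))
    (fun v w h => finProdFinEquiv.injective
      (Fin.castSucc_injective _ (σ.injective (Fin.ext h)))) (fun v => (σ _).isLt)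
  refine two_pow_le_size_of_matching (gridGraph n) _ ?_ σ D hD k hk
    (fun i => finProdFinEquiv (a i)) (fun i => finProdFinEquiv (b i)) ha hb fun i j => ?_
  · simp [ket]
  · rw [← hab i j, gridGraph, SimpleGraph.comap_adj, Equiv.symm_apply_apply,
      Equiv.symm_apply_apply]

lemma exists_eval_lt_two_pow (p : Polynomial ℕ) : ∃ n : ℕ, p.eval (n * n + 1) < 2 ^ (n / 12) := by
  -- along `n = 24 j` the right side is `4 ^ j`, which exceeds `exp j`
  let q : Polynomial ℕ := p.comp (Polynomial.C 576 * Polynomial.X ^ 2 + 1)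
  have hlim := (Polynomial.tendsto_div_exp_atTop (q.map (Nat.castRingHom ℝ))).comp
    tendsto_natCast_atTop_atTop
  obtain ⟨j, hj⟩ := (hlim.eventually (gt_mem_nhds one_pos)).exists
  refine ⟨24 * j, ?_⟩
  have hq : q.eval j = p.eval (24 * j * (24 * j) + 1) := by
    simp only [q, Polynomial.eval_comp, Polynomial.eval_add, Polynomial.eval_mul,
      Polynomial.eval_C, Polynomial.eval_pow, Polynomial.eval_X, Polynomial.eval_one]
    congr 1
    ring
  rw [Function.comp_apply, div_lt_one (Real.exp_pos _), Polynomial.eval_natCast_map] at hj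
  have hexp : Real.exp j ≤ 4 ^ j := by
    rw [← mul_one (j : ℝ), Real.exp_nat_mul]
    exact pow_le_pow_left₀ (Real.exp_pos _).le
      (Real.exp_one_lt_d9.le.trans (by norm_num)) j
  have h4 : 2 ^ (24 * j / 12) = 4 ^ j := by
    rw [show 24 * j / 12 = 2 * j by omega, pow_mul]
    norm_num
  rw [← hq, h4]
  have hreal : ((q.eval j : ℕ) : ℝ) < ((4 ^ j : ℕ) : ℝ) := by
    push_cast
    exact lt_of_eq_of_lt (by simp) (hj.trans_le hexp)
  exact Nat.cast_lt.mp hreal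

/-! ### The comparison of the classes of families -/

/-- The family of the states `witnessState n`. -/
noncomputable def witnessFamily : StateFamily where
  qubits n := n * n + 1
  state := witnessState
  ne_zero := witnessState_ne_zero

lemma polySizeFamilies_subset_anyOrder (G : Subgroup (GL (Fin 2) ℂ)) :
    polySizeFamilies G ⊆ polySizeAnyOrderFamilies G := fun _ ⟨p, hp⟩ =>
  ⟨p, fun i => ⟨1, hp i⟩⟩

lemma stabilizerFamilies_subset : stabilizerFamilies ⊆ polySizeFamilies pauliGroup := by
  intro F hF
  refine ⟨Polynomial.X, fun i => ?_⟩
  obtain ⟨D, hD, hs⟩ := (hF i).exists_pauliLIMDD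
  exact ⟨D, hD, by rw [hs, Polynomial.eval_X]⟩

lemma polySizeFamilies_mono {G H : Subgroup (GL (Fin 2) ℂ)} (h : G ≤ H) :
    polySizeFamilies G ⊆ polySizeFamilies H := by
  rintro F ⟨p, hp⟩
  refine ⟨p, fun i => ?_⟩
  obtain ⟨D, hD, hs⟩ := hp i
  obtain ⟨E, hE, he⟩ := D.exists_of_le h
  exact ⟨E, hE.trans hD, he.le.trans hs⟩

lemma polySizeAnyOrderFamilies_mono {G H : Subgroup (GL (Fin 2) ℂ)} (h : G ≤ H) :
    polySizeAnyOrderFamilies G ⊆ polySizeAnyOrderFamilies H := by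
  rintro F ⟨p, hp⟩
  refine ⟨p, fun i => ?_⟩
  obtain ⟨σ, D, hD, hs⟩ := hp i
  obtain ⟨E, hE, he⟩ := D.exists_of_le h
  exact ⟨σ, E, hE.trans hD, he.le.trans hs⟩

lemma witnessFamily_mem : witnessFamily ∈ polySizeFamilies pauliGroup := by
  refine ⟨Polynomial.X, fun n => ?_⟩
  obtain ⟨D, hD, hs⟩ := exists_pauliLIMDD_witnessState n
  exact ⟨D, hD, by rwa [Polynomial.eval_X]⟩

lemma witnessFamily_notMem_stabilizerFamilies : witnessFamily ∉ stabilizerFamilies :=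
  fun h => not_isStabilizerState_witnessState 0 (h 0)

lemma witnessFamily_notMem_polySizeAnyOrderFamilies :
    witnessFamily ∉ polySizeAnyOrderFamilies ⊥ := by
  rintro ⟨p, hp⟩
  obtain ⟨n, hn⟩ := exists_eval_lt_two_pow p
  obtain ⟨σ, D, hD, hs⟩ := hp n
  exact absurd (two_pow_le_size_of_vec_eq_witnessState n σ D hD) (not_le.mpr (hs.trans_lt hn))

theorem mainTheorem1 :
    (stabilizerFamilies ∪ polySizeFamilies ⊥ ⊂ polySizeFamilies pauliGroup) ∧
    (stabilizerFamilies ∪ polySizeAnyOrderFamilies ⊥ ⊂ polySizeAnyOrderFamilies pauliGroup) ∧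
    (∀ n : ℕ,
      ¬ IsStabilizerState (witnessState n) ∧
      (∀ (σ : Equiv.Perm (Fin (n * n + 1))) (D : QMDD (n * n + 1)),
        D.vec = permuteQubits σ (witnessState n) → 2 ^ (n / 12) ≤ D.size) ∧
      (∃ D : PauliLIMDD (n * n + 1), D.vec = witnessState n ∧ D.size ≤ n * n + 1)) := by
  refine ⟨?_, ?_, fun n => ⟨not_isStabilizerState_witnessState n,
    two_pow_le_size_of_vec_eq_witnessState n, exists_pauliLIMDD_witnessState n⟩⟩
  · refine (Set.ssubset_iff_of_subset
      (Set.union_subset stabilizerFamilies_subset (polySizeFamilies_mono bot_le))).mpr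
      ⟨witnessFamily, witnessFamily_mem, ?_⟩
    rintro (h | h)
    · exact witnessFamily_notMem_stabilizerFamilies h
    · exact witnessFamily_notMem_polySizeAnyOrderFamilies (polySizeFamilies_subset_anyOrder _ h)
  · refine (Set.ssubset_iff_of_subset (Set.union_subset
      (stabilizerFamilies_subset.trans (polySizeFamilies_subset_anyOrder _))
      (polySizeAnyOrderFamilies_mono bot_le))).mpr
      ⟨witnessFamily, polySizeFamilies_subset_anyOrder _ witnessFamily_mem, ?_⟩
    rintro (h | h)
    · exact witnessFamily_notMem_stabilizerFamilies h
    · exact witnessFamily_notMem_polySizeAnyOrderFamilies h
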